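/- For $d\ge 0$ let $\mathcal P_d\subset\mathbb R^d$ be the pellytope, i.e. the Newton polytope of the polynomial $\prod_{i=1}^d(1+y_i)\prod_{j=1}^{d-1}(1+y_j+y_jy_{j+1})$, and let $\Sigma_d$ be its inner normal fan: the set of the cones $\{w\in\mathbb R^d \mid \langle w,x\rangle\le\langle w,y\rangle \text{ for all } x\in F,\ y\in\mathcal P_d\}$, where $F$ runs over the non-empty faces of $\mathcal P_d$ (so $\Sigma_0=\{\{0\}\}$). For a fan $\Sigma$ in $\mathbb R^d$ and $\tau\in\Sigma$ with linear span $L(\tau)$, let $\mathrm{Star}_\Sigma(\tau)=\{\pi(\sigma)\mid \tau\subseteq\sigma\in\Sigma\}$, where $\pi\colon\mathbb R^d\to\mathbb R^d/L(\tau)$ is the projection. The product of fans is $\Sigma\times\Sigma'=\{C\times C'\mid C\in\Sigma,\ C'\in\Sigma'\}$. Write $\rho_v=\mathbb R_{\ge0}v$, and let $e_1,\dots,e_d$ be the standard basis of $\mathbb R^d$. **Lemma.** Let $d\ge1$. The rays (one-dimensional cones) of $\Sigma_d$ are exactly the $\rho_v$ with $v\in\{\pm e_1,\dots,\pm e_d,\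 e_1-e_2,\dots,e_{d-1}-e_d\}$, and $$\mathrm{Star}_{\Sigma_d}(\rho_v)=\begin{cases}\Sigma_{d-1}& v\in\{\pm e_1,\pm e_d\},\\ \Sigma_{i-1}\times\Sigma_{d-i}& v=\pm e_i,\ 1<i<d,\\ \Sigma_{d-2}\times\Sigma_1& v\in\{e_1-e_2,\ e_{d-1}-e_d\}\ (d\ge2),\\ \Sigma_{i-1}\times\Sigma_1\times\Sigma_{d-i-1}& v=e_i-e_{i+1},\ 2\le i\le d-2.\end{cases}$$ Here equality means that the fans correspond under the linear isomorphism from $\mathbb R^d/L(\rho_v)$ to $\mathbb R^{d-1}$ (written as the corresponding product of coordinate spaces) that is induced by the following map on $\mathbb R^d$: for $v=\pm e_i$ with $1\le i\le d$, $x\mapsto(x_1,\dots,x_{i-1},x_{i+1},\dots,x_d)$, split after the first $i-1$ coordinates when $1<i<d$; for $v=e_1-e_2$, $x\mapsto((x_3,\dots,x_d),\,x_1+x_2)$; for $v=e_{d-1}-e_d$, $x\mapsto((x_1,\dots,x_{d-2}),\,x_{d-1}+x_d)$; for $v=e_i-e_{i+1}$ with $2\le i\le d-2$, $x\mapsto((x_1,\dots,x_{i-1}),\,x_i+x_{i+1},\,(x_{i+2},\dots,x_d))$.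 -/

import Mathlib

/-- The Newton polytope of a polynomial: the convex hull of its exponent vectors. -/
def newtonPolytope {ι R : Type*} [CommSemiring R] (f : MvPolynomial ι R) : Set (ι → ℝ) :=
  convexHull ℝ ((fun (m : ι →₀ ℕ) (i : ι) => (m i : ℝ)) '' (f.support : Set (ι →₀ ℕ)))

/-- The polynomial `∏_{i=1}^d (1 + y_i) * ∏_{j=1}^{d-1} (1 + y_j + y_j y_{j+1})`; the variables
`y_1, …, y_d` are indexed by `0, …, d - 1`. -/
noncomputable def pellPolynomial (d : ℕ) : MvPolynomial (Fin d) ℤ :=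
  (∏ i : Fin d, (1 + MvPolynomial.X i)) *
    ∏ j : Fin (d - 1),
      (1 + MvPolynomial.X (⟨j.val, by omega⟩ : Fin d) +
        MvPolynomial.X (⟨j.val, by omega⟩ : Fin d) *
          MvPolynomial.X (⟨j.val + 1, by omega⟩ : Fin d))

/-- The pellytope `P_d` in `ℝ^d` (a point for `d = 0`). -/
noncomputable def pellytope (d : ℕ) : Set (Fin d → ℝ) :=
  newtonPolytope (pellPolynomial d)

/-- The face of `P` on which the linear functional `⟨u, ·⟩` is minimal. For a polytope `P`, these
are exactly the non-empty faces of `P`. -/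
def minFace {n : ℕ} (P : Set (Fin n → ℝ)) (u : Fin n → ℝ) : Set (Fin n → ℝ) :=
  {x | x ∈ P ∧ ∀ y ∈ P, u ⬝ᵥ x ≤ u ⬝ᵥ y}

/-- The inner normal cone of `P` along `F`: all `w` such that `⟨w, ·⟩` attains its minimum over `P`
at every point of `F`. -/
def innerNormalCone {n : ℕ} (P F : Set (Fin n → ℝ)) : PointedCone ℝ (Fin n → ℝ) where
  carrier := {w | ∀ x ∈ F, ∀ y ∈ P, w ⬝ᵥ x ≤ w ⬝ᵥ y}
  add_mem' := by
    intro a b ha hb x hx y hy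
    rw [add_dotProduct, add_dotProduct]
    exact add_le_add (ha x hx y hy) (hb x hx y hy)
  zero_mem' := by
    intro x _ y _
    rw [zero_dotProduct, zero_dotProduct]
  smul_mem' := by
    intro c a ha x hx y hy
    change ((c : ℝ) • a) ⬝ᵥ x ≤ ((c : ℝ) • a) ⬝ᵥ y
    rw [smul_dotProduct, smul_dotProduct]
    exact mul_le_mul_of_nonneg_left (ha x hx y hy) c.2

/-- The inner normal fan of a polytope, as the set of the normal cones of its non-empty faces. -/
def innerNormalFan {n : ℕ} (P : Set (Fin n → ℝ)) : Set (PointedCone ℝ (Fin n → ℝ)) :=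
  {C | ∃ u : Fin n → ℝ, C = innerNormalCone P (minFace P u)}

/-- The pellytope fan `Σ_d`, the inner normal fan of the pellytope `P_d`. -/
noncomputable def pellFan (d : ℕ) : Set (PointedCone ℝ (Fin d → ℝ)) :=
  innerNormalFan (pellytope d)

/-- The cone generated by the single vector `v`. -/
def ray {V : Type*} [AddCommGroup V] [Module ℝ V] (v : V) : PointedCone ℝ V :=
  PointedCone.hull ℝ {v}

/-- The linear span `L(τ)` of a cone `τ`. -/
def linSpan {V : Type*} [AddCommGroup V] [Module ℝ V] (τ : PointedCone ℝ V) : Submodule ℝ V :=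
  Submodule.span ℝ (τ : Set V)

/-- The star of `τ` in a collection of cones: the images in `V / L(τ)` of the cones that
contain `τ`. -/
def fanStar {V : Type*} [AddCommGroup V] [Module ℝ V] (S : Set (PointedCone ℝ V))
    (τ : PointedCone ℝ V) : Set (PointedCone ℝ (V ⧸ linSpan τ)) :=
  {C | ∃ σ ∈ S, τ ≤ σ ∧ C = PointedCone.map (linSpan τ).mkQ σ}

/-- The product of two fans. -/
def fanProd {V W : Type*} [AddCommGroup V] [Module ℝ V] [AddCommGroup W] [Module ℝ W]
    (S : Set (PointedCone ℝ V)) (T : Set (PointedCone ℝ W)) : Set (PointedCone ℝ (V × W)) :=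
  {C | ∃ σ ∈ S, ∃ τ ∈ T, C = Submodule.prod σ τ}

/-- The linear isomorphism `φ` identifies the fan `S` with the fan `T`. -/
def IsFanIso {V W : Type*} [AddCommGroup V] [Module ℝ V] [AddCommGroup W] [Module ℝ W]
    (φ : V ≃ₗ[ℝ] W) (S : Set (PointedCone ℝ V)) (T : Set (PointedCone ℝ W)) : Prop :=
  PointedCone.map (φ : V →ₗ[ℝ] W) '' S = T

/-- The standard basis vector `e_i` of `ℝ^d` for `1 ≤ i ≤ d`, counted from `1`. -/
def stdVec (d i : ℕ) : Fin d → ℝ := fun k => if k.val + 1 = i then 1 else 0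

/-- The `3d - 1` vectors `e_1, …, e_d, -e_1, …, -e_d, e_1 - e_2, …, e_{d-1} - e_d`. -/
def pellGenerators (d : ℕ) : Set (Fin d → ℝ) :=
  {v | (∃ i, 1 ≤ i ∧ i ≤ d ∧ (v = stdVec d i ∨ v = -stdVec d i)) ∨
    (∃ i, 1 ≤ i ∧ i + 1 ≤ d ∧ v = stdVec d i - stdVec d (i + 1))}

/-- The rays (one-dimensional cones) of a fan. -/
def fanRays {V : Type*} [AddCommGroup V] [Module ℝ V] (S : Set (PointedCone ℝ V)) :
    Set (PointedCone ℝ V) :=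
  {ρ | ρ ∈ S ∧ Module.finrank ℝ (linSpan ρ) = 1}

/-! The polynomial is a product with nonnegative coefficients, so its exponent set is the Minkowski
sum of those of its factors, and `w` lies in the normal cone of the face minimizing `u` exactly when
this holds for every factor. A factor `1 + y_i` compares the signs of `u_i` and `w_i`. Once these
are matched, a factor `1 + y_j + y_j y_{j+1}` adds a condition only if `u_j > 0 > u_{j+1}`, and then
it compares the signs of `u_j + u_{j+1}` and `w_j + w_{j+1}`. This is `PellLE`
(`mem_innerNormalCone_pellytope`); everything after it is about sign conditions.

Rays: a cone contains no line, every cone of a nonzero `u` contains one of the listed vectors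
(`exists_pellGenerator_mem`), and the cone of a listed vector is its ray (`pellCone_generator`).

Stars: if the cone of `u` contains `e_i` or `-e_i`, the conditions on `w` that involve `w_i` hold as
soon as `w_i` is large of the right sign. The others separate into those on the coordinates before
`i` and those after. If the cone contains `e_i - e_{i+1}`, then `u_i > 0 > u_{i+1}`, so the sum
conditions at the pairs `(i-1, i)` and `(i+1, i+2)` are void, and modulo this vector the pair `i,
i+1` leaves only the sign of its sum, a copy of `Σ_1`. -/

open scoped Pointwise

/-- `t` lies in the closed half-lines at the origin that contain `s`. -/
def SignLE (s t : ℝ) : Prop := (0 ≤ s → 0 ≤ t) ∧ (s ≤ 0 → t ≤ 0)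

/-- The combinatorial description of the relation "`w` lies in the cone of the pellytope fan whose
relative interior contains `u`". -/
def PellLE {d : ℕ} (u w : Fin d → ℝ) : Prop :=
  (∀ k (hk : k < d), SignLE (u ⟨k, hk⟩) (w ⟨k, hk⟩)) ∧
    ∀ k (hk : k + 1 < d), 0 < u ⟨k, by omega⟩ → u ⟨k + 1, hk⟩ < 0 →
      SignLE (u ⟨k, by omega⟩ + u ⟨k + 1, hk⟩) (w ⟨k, by omega⟩ + w ⟨k + 1, hk⟩)

/-! ### Normal cones of convex hulls and Minkowski sums -/

theorem minFace_nonempty {n : ℕ} {A : Set (Fin n → ℝ)} (hA : A.Finite) (hne : A.Nonempty)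
    (u : Fin n → ℝ) : (minFace A u).Nonempty := by
  obtain ⟨x, hx, h⟩ := Set.exists_min_image A (fun x => u ⬝ᵥ x) hA hne
  exact ⟨x, hx, h⟩

theorem mem_innerNormalCone {n : ℕ} {P F : Set (Fin n → ℝ)} {w : Fin n → ℝ} :
    w ∈ innerNormalCone P F ↔ ∀ x ∈ F, ∀ y ∈ P, w ⬝ᵥ x ≤ w ⬝ᵥ y := Iff.rfl

/-- In a convex combination that minimizes `u`, the weighted excesses over the minimum are
nonnegative and sum to zero, so only minimizing points carry weight. -/
theorem minFace_convexHull_subset {n : ℕ} {A : Set (Fin n → ℝ)} (hA : A.Finite) (u : Fin n → ℝ) :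
    minFace (convexHull ℝ A) u ⊆ convexHull ℝ (minFace A u) := by
  rintro x ⟨hx, hmin⟩
  lift A to Finset (Fin n → ℝ) using hA
  rw [Finset.mem_convexHull'] at hx
  obtain ⟨c, hc0, hc1, rfl⟩ := hx
  set x := ∑ y ∈ A, c y • y with hxdef
  have hle : ∀ y ∈ A, u ⬝ᵥ x ≤ u ⬝ᵥ y := fun y hy => hmin y (subset_convexHull ℝ _ hy)
  have hsum : ∑ y ∈ A, c y * (u ⬝ᵥ y - u ⬝ᵥ x) = 0 := by
    have h1 : u ⬝ᵥ x = ∑ y ∈ A, c y * (u ⬝ᵥ y) := by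
      rw [hxdef, dotProduct_sum]
      simp only [dotProduct_smul, smul_eq_mul]
    simp only [mul_sub, Finset.sum_sub_distrib, ← Finset.sum_mul, hc1, ← h1]
    ring
  have hzero := (Finset.sum_eq_zero_iff_of_nonneg
    (fun y hy => mul_nonneg (hc0 y hy) (sub_nonneg.2 (hle y hy)))).1 hsum
  have hconv : Convex ℝ (convexHull ℝ (minFace (A : Set (Fin n → ℝ)) u)) := convex_convexHull ℝ _
  have hx' : x = ∑ y ∈ A with c y ≠ 0, c y • y := by
    rw [hxdef, Finset.sum_filter_of_ne]
    intro y _ hy h0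
    simp [h0] at hy
  rw [hx']
  refine hconv.sum_mem (fun y hy => hc0 y (Finset.mem_filter.1 hy).1) ?_ ?_
  · rw [Finset.sum_filter_ne_zero, hc1]
  · intro y hy
    obtain ⟨hyA, hy0⟩ := Finset.mem_filter.1 hy
    refine subset_convexHull ℝ _ ⟨hyA, fun z hz => ?_⟩
    have := (mul_eq_zero.1 (hzero y hyA)).resolve_left hy0
    linarith [hle z hz]

theorem le_dotProduct_of_mem_convexHull {n : ℕ} {A : Set (Fin n → ℝ)} {w : Fin n → ℝ} {c : ℝ}
    (h : ∀ y ∈ A, c ≤ w ⬝ᵥ y) {x : Fin n → ℝ} (hx : x ∈ convexHull ℝ A) : c ≤ w ⬝ᵥ x := by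
  have hc : Convex ℝ {y : Fin n → ℝ | c ≤ w ⬝ᵥ y} :=
    convex_halfSpace_ge ⟨fun a b => dotProduct_add w a b, fun a b => dotProduct_smul a w b⟩ c
  exact convexHull_min h hc hx

theorem dotProduct_le_of_mem_convexHull {n : ℕ} {A : Set (Fin n → ℝ)} {w : Fin n → ℝ} {c : ℝ}
    (h : ∀ y ∈ A, w ⬝ᵥ y ≤ c) {x : Fin n → ℝ} (hx : x ∈ convexHull ℝ A) : w ⬝ᵥ x ≤ c := by
  have hc : Convex ℝ {y : Fin n → ℝ | w ⬝ᵥ y ≤ c} :=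
    convex_halfSpace_le ⟨fun a b => dotProduct_add w a b, fun a b => dotProduct_smul a w b⟩ c
  exact convexHull_min h hc hx

theorem mem_innerNormalCone_convexHull {n : ℕ} {A : Set (Fin n → ℝ)} (hA : A.Finite)
    (u w : Fin n → ℝ) :
    w ∈ innerNormalCone (convexHull ℝ A) (minFace (convexHull ℝ A) u) ↔
      w ∈ innerNormalCone A (minFace A u) := by
  constructor
  · intro h x hx y hy
    exact h x ⟨subset_convexHull ℝ _ hx.1, fun z hz => le_dotProduct_of_mem_convexHull hx.2 hz⟩ y
      (subset_convexHull ℝ _ hy)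
  · intro h x hx y hy
    refine le_dotProduct_of_mem_convexHull (fun z hz => ?_) hy
    exact dotProduct_le_of_mem_convexHull (fun t ht => h t ht z hz)
      (minFace_convexHull_subset hA u hx)

/-- A sum is minimal exactly when both summands are. Finiteness and nonemptiness provide a minimizer
of one summand to hold fixed while the other varies. -/
theorem mem_innerNormalCone_add {n : ℕ} {A B : Set (Fin n → ℝ)} (hA : A.Finite) (hA' : A.Nonempty)
    (hB : B.Finite) (hB' : B.Nonempty) (u w : Fin n → ℝ) :
    w ∈ innerNormalCone (A + B) (minFace (A + B) u) ↔
      w ∈ innerNormalCone A (minFace A u) ∧ w ∈ innerNormalCone B (minFace B u) := by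
  have hadd : ∀ a ∈ minFace A u, ∀ b ∈ minFace B u, a + b ∈ minFace (A + B) u := by
    rintro a ⟨ha, ha'⟩ b ⟨hb, hb'⟩
    refine ⟨Set.add_mem_add ha hb, ?_⟩
    rintro _ ⟨a', haa, b', hbb, rfl⟩
    simp only [dotProduct_add]
    exact add_le_add (ha' a' haa) (hb' b' hbb)
  constructor
  · intro h
    obtain ⟨a₀, ha₀⟩ := minFace_nonempty hA hA' u
    obtain ⟨b₀, hb₀⟩ := minFace_nonempty hB hB' u
    constructor
    · intro a ha y hy
      have := h _ (hadd a ha b₀ hb₀) _ (Set.add_mem_add hy hb₀.1)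
      simpa only [dotProduct_add, add_le_add_iff_right] using this
    · intro b hb y hy
      have := h _ (hadd a₀ ha₀ b hb) _ (Set.add_mem_add ha₀.1 hy)
      simpa only [dotProduct_add, add_le_add_iff_left] using this
  · rintro ⟨h₁, h₂⟩ _ ⟨⟨a, ha, b, hb, rfl⟩, hmin⟩ _ ⟨a', ha', b', hb', rfl⟩
    simp only [dotProduct_add]
    refine add_le_add (h₁ a ⟨ha, fun z hz => ?_⟩ a' ha') (h₂ b ⟨hb, fun z hz => ?_⟩ b' hb')
    · have := hmin _ (Set.add_mem_add hz hb)
      simpa only [dotProduct_add, add_le_add_iff_right] using this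
    · have := hmin _ (Set.add_mem_add ha hz)
      simpa only [dotProduct_add, add_le_add_iff_left] using this

/-! ### Exponent sets of products -/

/-- The exponent vectors of a polynomial, as real vectors. -/
def exponents {ι R : Type*} [CommSemiring R] (f : MvPolynomial ι R) : Set (ι → ℝ) :=
  (fun (m : ι →₀ ℕ) (i : ι) => (m i : ℝ)) '' (f.support : Set (ι →₀ ℕ))

theorem exponents_finite {ι R : Type*} [CommSemiring R] (f : MvPolynomial ι R) :
    (exponents f).Finite :=
  f.support.finite_toSet.image _

theorem exponents_add {ι : Type*} (f g : MvPolynomial ι ℕ) :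
    exponents (f + g) = exponents f ∪ exponents g := by
  rw [exponents, exponents, exponents, ← Set.image_union]
  congr 1
  ext m
  simp only [Finset.mem_coe, MvPolynomial.mem_support_iff, MvPolynomial.coeff_add, Set.mem_union]
  omega

/-- Over `ℕ` no terms cancel, so a coefficient of the product is nonzero as soon as one of its
contributions is. -/
theorem exponents_mul {ι : Type*} (f g : MvPolynomial ι ℕ) :
    exponents (f * g) = exponents f + exponents g := by
  classical
  ext x
  simp only [exponents, Set.mem_image, Set.mem_add, Finset.mem_coe, MvPolynomial.mem_support_iff,
    MvPolynomial.coeff_mul]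
  constructor
  · rintro ⟨m, hm, rfl⟩
    obtain ⟨⟨p, q⟩, hpq, h⟩ := Finset.exists_ne_zero_of_sum_ne_zero hm
    refine ⟨_, ⟨p, left_ne_zero_of_mul h, rfl⟩, _, ⟨q, right_ne_zero_of_mul h, rfl⟩, ?_⟩
    rw [← Finset.HasAntidiagonal.mem_antidiagonal.1 hpq]
    ext i
    simp
  · rintro ⟨_, ⟨p, hp, rfl⟩, _, ⟨q, hq, rfl⟩, rfl⟩
    refine ⟨p + q, ?_, by ext i; simp⟩
    intro h
    rw [Finset.sum_eq_zero_iff] at h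
    exact mul_ne_zero hp hq (h (p, q) (by simp))

theorem exponents_one {ι : Type*} : exponents (1 : MvPolynomial ι ℕ) = {0} := by
  rw [exponents, MvPolynomial.support_one]
  ext x
  simp [funext_iff]

theorem exponents_X {ι : Type*} [DecidableEq ι] (i : ι) :
    exponents (MvPolynomial.X i : MvPolynomial ι ℕ) = {Pi.single i 1} := by
  rw [exponents, MvPolynomial.support_X]
  ext x
  simp only [Finset.coe_singleton, Set.image_singleton, Set.mem_singleton_iff]
  have : (fun k => ((Finsupp.single i 1 : ι →₀ ℕ) k : ℝ)) = Pi.single i 1 := by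
    ext k
    by_cases h : k = i
    · subst h; simp
    · simp [h]
  rw [this]

theorem mem_innerNormalCone_exponents_mul {n : ℕ} {f g : MvPolynomial (Fin n) ℕ}
    (hf : (exponents f).Nonempty) (hg : (exponents g).Nonempty) (u w : Fin n → ℝ) :
    w ∈ innerNormalCone (exponents (f * g)) (minFace (exponents (f * g)) u) ↔
      w ∈ innerNormalCone (exponents f) (minFace (exponents f) u) ∧
      w ∈ innerNormalCone (exponents g) (minFace (exponents g) u) := by
  rw [exponents_mul]
  exact mem_innerNormalCone_add (exponents_finite f) hf (exponents_finite g) hg u w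

theorem mem_innerNormalCone_exponents_prod {n : ℕ} {κ : Type*} (s : Finset κ)
    (f : κ → MvPolynomial (Fin n) ℕ) (hf : ∀ k, (exponents (f k)).Nonempty) (u w : Fin n → ℝ) :
    (exponents (∏ k ∈ s, f k)).Nonempty ∧
    (w ∈ innerNormalCone (exponents (∏ k ∈ s, f k)) (minFace (exponents (∏ k ∈ s, f k)) u) ↔
      ∀ k ∈ s, w ∈ innerNormalCone (exponents (f k)) (minFace (exponents (f k)) u)) := by
  classical
  induction s using Finset.induction_on with
  | empty =>
    refine ⟨by simp [exponents_one], ?_⟩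
    simp only [Finset.prod_empty, exponents_one, Finset.notMem_empty, false_imp_iff,
      implies_true, iff_true]
    rintro x ⟨rfl, _⟩ y rfl
    exact le_rfl
  | insert a s ha ih =>
    rw [Finset.prod_insert ha]
    refine ⟨by rw [exponents_mul]; exact (hf a).add ih.1, ?_⟩
    rw [mem_innerNormalCone_exponents_mul (hf a) ih.1, ih.2, Finset.forall_mem_insert]

theorem exponents_map {ι : Type*} (f : MvPolynomial ι ℕ) :
    exponents (MvPolynomial.map (Nat.castRingHom ℤ) f) = exponents f := by
  rw [exponents, exponents, MvPolynomial.support_map_of_injective _ Nat.cast_injective]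

theorem pellPolynomial_eq_map (d : ℕ) :
    pellPolynomial d = MvPolynomial.map (Nat.castRingHom ℤ)
      ((∏ i : Fin d, (1 + MvPolynomial.X i)) *
        ∏ j : Fin (d - 1),
          (1 + MvPolynomial.X (⟨j.val, by omega⟩ : Fin d) +
            MvPolynomial.X (⟨j.val, by omega⟩ : Fin d) *
              MvPolynomial.X (⟨j.val + 1, by omega⟩ : Fin d))) := by
  simp [pellPolynomial]

/-! ### The cones of the pellytope fan as sign conditions -/

theorem mem_innerNormalCone_segment {n : ℕ} (i : Fin n) (u w : Fin n → ℝ) :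
    w ∈ innerNormalCone (exponents (1 + MvPolynomial.X i : MvPolynomial (Fin n) ℕ))
      (minFace (exponents (1 + MvPolynomial.X i : MvPolynomial (Fin n) ℕ)) u) ↔
      SignLE (u i) (w i) := by
  rw [exponents_add, exponents_one, exponents_X, mem_innerNormalCone]
  simp [minFace, SignLE]
  exact and_comm

/-- The functional `u` takes the values `0`, `u i`, `u i + u j` at the vertices. The signs of `u i`
and `u j` settle which are minimal, except when `u i > 0 > u j`, where `0` competes with `u i + u
j`. -/
theorem mem_innerNormalCone_triangle {n : ℕ} (i j : Fin n) (u w : Fin n → ℝ)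
    (hi : SignLE (u i) (w i)) (hj : SignLE (u j) (w j)) :
    w ∈ innerNormalCone
      (exponents (1 + MvPolynomial.X i + MvPolynomial.X i * MvPolynomial.X j :
        MvPolynomial (Fin n) ℕ))
      (minFace (exponents (1 + MvPolynomial.X i + MvPolynomial.X i * MvPolynomial.X j :
        MvPolynomial (Fin n) ℕ)) u) ↔
      (0 < u i → u j < 0 → SignLE (u i + u j) (w i + w j)) := by
  rw [exponents_add, exponents_add, exponents_mul, exponents_one, exponents_X, exponents_X,
    mem_innerNormalCone]
  simp [minFace]
  unfold SignLE at *
  grind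

theorem mem_innerNormalCone_pellytope {d : ℕ} (u w : Fin d → ℝ) :
    w ∈ innerNormalCone (pellytope d) (minFace (pellytope d) u) ↔ PellLE u w := by
  have h1 : ∀ i : Fin d, (exponents (1 + MvPolynomial.X i : MvPolynomial (Fin d) ℕ)).Nonempty :=
    fun i => by simp [exponents_add, exponents_one]
  have h2 : ∀ j : Fin (d - 1), (exponents (1 + MvPolynomial.X (⟨j.val, by omega⟩ : Fin d) +
            MvPolynomial.X (⟨j.val, by omega⟩ : Fin d) *
              MvPolynomial.X (⟨j.val + 1, by omega⟩ : Fin d) :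
                MvPolynomial (Fin d) ℕ)).Nonempty :=
    fun j => by simp [exponents_add, exponents_one]
  have hP : pellytope d = convexHull ℝ (exponents (pellPolynomial d)) := rfl
  rw [hP, mem_innerNormalCone_convexHull (exponents_finite _), pellPolynomial_eq_map,
    exponents_map, mem_innerNormalCone_exponents_mul
      (mem_innerNormalCone_exponents_prod _ _ h1 u w).1
      (mem_innerNormalCone_exponents_prod _ _ h2 u w).1,
    (mem_innerNormalCone_exponents_prod _ _ h1 u w).2,
    (mem_innerNormalCone_exponents_prod _ _ h2 u w).2]
  simp only [Finset.mem_univ, true_imp_iff, mem_innerNormalCone_segment, PellLE]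
  constructor
  · rintro ⟨h, h'⟩
    exact ⟨fun k hk => h _, fun k hk => (mem_innerNormalCone_triangle _ _ u w (h _) (h _)).1
      (h' ⟨k, by omega⟩)⟩
  · rintro ⟨h, h'⟩
    exact ⟨fun i => h i.1 i.2, fun j => (mem_innerNormalCone_triangle _ _ u w (h _ _) (h _ _)).2
      (h' j.1 (by omega))⟩

/-- The cone of the pellytope fan whose relative interior contains `u`. -/
noncomputable def pellCone {d : ℕ} (u : Fin d → ℝ) : PointedCone ℝ (Fin d → ℝ) :=
  innerNormalCone (pellytope d) (minFace (pellytope d) u)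

theorem mem_pellCone {d : ℕ} {u w : Fin d → ℝ} : w ∈ pellCone u ↔ PellLE u w :=
  mem_innerNormalCone_pellytope u w

theorem pellFan_eq_range (d : ℕ) : pellFan d = Set.range (pellCone (d := d)) := by
  ext C
  simp [pellFan, innerNormalFan, pellCone, eq_comm]

theorem pellCone_mem_pellFan {d : ℕ} (u : Fin d → ℝ) : pellCone u ∈ pellFan d := ⟨u, rfl⟩

theorem pellFan_nonempty (d : ℕ) : (pellFan d).Nonempty := ⟨_, pellCone_mem_pellFan 0⟩

theorem SignLE.refl (s : ℝ) : SignLE s s := ⟨id, id⟩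

theorem SignLE.zero (s : ℝ) : SignLE s 0 := ⟨fun _ => le_rfl, fun _ => le_rfl⟩

theorem SignLE.eq_zero {s t : ℝ} (h : SignLE s t) (hs : s = 0) : t = 0 :=
  le_antisymm (h.2 hs.le) (h.1 hs.ge)

theorem SignLE.pos {s t : ℝ} (h : SignLE s t) (ht : 0 < t) : 0 < s := by
  by_contra hs
  exact absurd (h.2 (not_lt.1 hs)) (not_le.2 ht)

theorem SignLE.neg {s t : ℝ} (h : SignLE s t) (ht : t < 0) : s < 0 := by
  by_contra hs
  exact absurd (h.1 (not_lt.1 hs)) (not_le.2 ht)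

theorem signLE_of_pos {s t : ℝ} (hs : 0 < s) (ht : 0 ≤ t) : SignLE s t :=
  ⟨fun _ => ht, fun h => absurd h (not_le.2 hs)⟩

theorem signLE_of_neg {s t : ℝ} (hs : s < 0) (ht : t ≤ 0) : SignLE s t :=
  ⟨fun h => absurd h (not_le.2 hs), fun _ => ht⟩

theorem PellLE.refl {d : ℕ} (u : Fin d → ℝ) : PellLE u u :=
  ⟨fun _ _ => .refl _, fun _ _ _ _ => .refl _⟩

theorem PellLE.eq_zero_of_neg {d : ℕ} {u w : Fin d → ℝ} (h : PellLE u w) (h' : PellLE u (-w)) :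
    w = 0 := by
  ext ⟨k, hk⟩
  have h1 := h.1 k hk
  have h2 := h'.1 k hk
  simp only [Pi.neg_apply, SignLE, Pi.zero_apply] at *
  rcases le_total 0 (u ⟨k, hk⟩) with hu | hu
  · linarith [h1.1 hu, h2.1 hu]
  · linarith [h1.2 hu, h2.2 hu]

/-! ### Rays, and stars computed through a linear map -/

theorem mem_ray {V : Type*} [AddCommGroup V] [Module ℝ V] {v x : V} :
    x ∈ ray v ↔ ∃ c : ℝ, 0 ≤ c ∧ c • v = x := by
  rw [ray, PointedCone.hull, Submodule.mem_span_singleton]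
  exact ⟨fun ⟨c, hc⟩ => ⟨c, c.2, hc⟩, fun ⟨c, hc, h⟩ => ⟨⟨c, hc⟩, h⟩⟩

theorem self_mem_ray {V : Type*} [AddCommGroup V] [Module ℝ V] (v : V) : v ∈ ray v :=
  mem_ray.2 ⟨1, zero_le_one, one_smul _ _⟩

theorem ray_le_iff {V : Type*} [AddCommGroup V] [Module ℝ V] {v : V} {σ : PointedCone ℝ V} :
    ray v ≤ σ ↔ v ∈ σ := by
  rw [ray, PointedCone.hull, Submodule.span_singleton_le_iff_mem]

theorem linSpan_ray {V : Type*} [AddCommGroup V] [Module ℝ V] (v : V) :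
    linSpan (ray v) = Submodule.span ℝ {v} := by
  refine le_antisymm (Submodule.span_le.2 fun x hx => ?_)
    (Submodule.span_mono (Set.singleton_subset_iff.2 (self_mem_ray v)))
  obtain ⟨c, -, rfl⟩ := mem_ray.1 hx
  exact Submodule.smul_mem _ _ (Submodule.mem_span_singleton_self v)

/-- Replaces the quotient by any surjection with kernel `ℝv`: the star becomes the set of images of
the cones containing `v`. -/
theorem exists_fanIso {V W : Type*} [AddCommGroup V] [Module ℝ V] [AddCommGroup W] [Module ℝ W]
    (S : Set (PointedCone ℝ V)) (T : Set (PointedCone ℝ W)) (v : V) (f : V →ₗ[ℝ] W)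
    (hf : Function.Surjective f) (hker : LinearMap.ker f = Submodule.span ℝ {v})
    (hT : PointedCone.map f '' {σ ∈ S | v ∈ σ} = T) :
    ∃ φ : (V ⧸ linSpan (ray v)) ≃ₗ[ℝ] W,
      (∀ x : V, φ ((linSpan (ray v)).mkQ x) = f x) ∧ IsFanIso φ (fanStar S (ray v)) T := by
  have hq : linSpan (ray v) = LinearMap.ker f := by rw [linSpan_ray, hker]
  let φ : (V ⧸ linSpan (ray v)) ≃ₗ[ℝ] W :=
    (Submodule.quotEquivOfEq _ _ hq).trans (f.quotKerEquivOfSurjective hf)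
  have hφ : (φ : (V ⧸ linSpan (ray v)) →ₗ[ℝ] W).comp (linSpan (ray v)).mkQ = f :=
    LinearMap.ext fun x => rfl
  refine ⟨φ, fun x => rfl, ?_⟩
  rw [← hT]
  ext C
  constructor
  · rintro ⟨_, ⟨σ, hσ, hv, rfl⟩, rfl⟩
    exact ⟨σ, ⟨hσ, ray_le_iff.1 hv⟩, by rw [PointedCone.map_map, hφ]⟩
  · rintro ⟨σ, ⟨hσ, hv⟩, rfl⟩
    exact ⟨_, ⟨σ, hσ, ray_le_iff.2 hv, rfl⟩, by rw [PointedCone.map_map, hφ]⟩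

theorem exists_fanIso_comp {V W W' : Type*} [AddCommGroup V] [Module ℝ V] [AddCommGroup W]
    [Module ℝ W] [AddCommGroup W'] [Module ℝ W']
    {S : Set (PointedCone ℝ V)} {T : Set (PointedCone ℝ W)} {T' : Set (PointedCone ℝ W')} {v : V}
    {f : V → W}
    (h : ∃ φ : (V ⧸ linSpan (ray v)) ≃ₗ[ℝ] W,
      (∀ x : V, φ ((linSpan (ray v)).mkQ x) = f x) ∧ IsFanIso φ (fanStar S (ray v)) T)
    (e : W ≃ₗ[ℝ] W') (hT : PointedCone.map (e : W →ₗ[ℝ] W') '' T = T') (f' : V → W')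
    (hf : ∀ x, e (f x) = f' x) :
    ∃ φ : (V ⧸ linSpan (ray v)) ≃ₗ[ℝ] W',
      (∀ x : V, φ ((linSpan (ray v)).mkQ x) = f' x) ∧ IsFanIso φ (fanStar S (ray v)) T' := by
  obtain ⟨φ, hφ, hS⟩ := h
  refine ⟨φ.trans e, fun x => by rw [← hf, ← hφ]; rfl, ?_⟩
  rw [IsFanIso] at *
  rw [← hT, ← hS, Set.image_image]
  exact Set.image_congr fun C _ => by rw [PointedCone.map_map]; rfl

/-! ### Linear images of product fans -/

section Product

variable {V W U : Type*} [AddCommGroup V] [Module ℝ V] [AddCommGroup W] [Module ℝ W]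
  [AddCommGroup U] [Module ℝ U]

theorem image_fanProd_eq {S : Set (PointedCone ℝ V)} {T : Set (PointedCone ℝ W)}
    {R : Set (PointedCone ℝ U)} (f : V × W →ₗ[ℝ] U)
    (h : ∀ C ∈ R, ∃ σ ∈ S, ∃ τ ∈ T, PointedCone.map f (Submodule.prod σ τ) = C)
    (h' : ∀ σ ∈ S, ∀ τ ∈ T, PointedCone.map f (Submodule.prod σ τ) ∈ R) :
    PointedCone.map f '' fanProd S T = R := by
  ext C
  constructor
  · rintro ⟨_, ⟨σ, hσ, τ, hτ, rfl⟩, rfl⟩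
    exact h' σ hσ τ hτ
  · intro hC
    obtain ⟨σ, hσ, τ, hτ, rfl⟩ := h C hC
    exact ⟨_, ⟨σ, hσ, τ, hτ, rfl⟩, rfl⟩

theorem image_snd_fanProd {S : Set (PointedCone ℝ V)} (hS : S.Nonempty)
    (T : Set (PointedCone ℝ W)) :
    PointedCone.map (LinearMap.snd ℝ V W) '' fanProd S T = T := by
  have key : ∀ (σ : PointedCone ℝ V) (τ : PointedCone ℝ W),
      PointedCone.map (LinearMap.snd ℝ V W) (Submodule.prod σ τ) = τ := by
    intro σ τ
    ext x
    simp only [PointedCone.mem_map, Submodule.mem_prod]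
    exact ⟨fun ⟨_, h, hx⟩ => hx ▸ h.2, fun hx => ⟨(0, x), ⟨σ.zero_mem, hx⟩, rfl⟩⟩
  obtain ⟨σ₀, hσ₀⟩ := hS
  exact image_fanProd_eq _ (fun C hC => ⟨σ₀, hσ₀, C, hC, key _ _⟩)
    fun σ _ τ hτ => (key σ τ).symm ▸ hτ

theorem image_swap_fanProd (S : Set (PointedCone ℝ V)) (T : Set (PointedCone ℝ W)) :
    PointedCone.map (LinearEquiv.prodComm ℝ V W : V × W →ₗ[ℝ] W × V) '' fanProd S T =
      fanProd T S := by
  have key : ∀ (σ : PointedCone ℝ V) (τ : PointedCone ℝ W),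
      PointedCone.map (LinearEquiv.prodComm ℝ V W : V × W →ₗ[ℝ] W × V) (Submodule.prod σ τ) =
        Submodule.prod τ σ := by
    intro σ τ
    ext ⟨x, y⟩
    simp only [PointedCone.mem_map, Submodule.mem_prod]
    constructor
    · rintro ⟨⟨a, b⟩, h, hx⟩
      cases hx
      exact h.symm
    · exact fun hx => ⟨(y, x), hx.symm, rfl⟩
  refine image_fanProd_eq _ ?_ fun σ hσ τ hτ => ⟨τ, hτ, σ, hσ, key σ τ⟩
  rintro _ ⟨τ, hτ, σ, hσ, rfl⟩
  exact ⟨σ, hσ, τ, hτ, key σ τ⟩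

theorem image_fst_fanProd (S : Set (PointedCone ℝ V))
    {T : Set (PointedCone ℝ W)} (hT : T.Nonempty) :
    PointedCone.map (LinearMap.fst ℝ V W) '' fanProd S T = S := by
  have h := image_snd_fanProd hT S
  rw [← image_swap_fanProd S T, Set.image_image] at h
  exact (Set.image_congr fun C _ => by rw [PointedCone.map_map]; rfl).trans h

theorem image_prodMap_fanProd {U' : Type*} [AddCommGroup U'] [Module ℝ U']
    (S : Set (PointedCone ℝ V)) (T : Set (PointedCone ℝ W))
    (f : V →ₗ[ℝ] U) (g : W →ₗ[ℝ] U') :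
    PointedCone.map (f.prodMap g) '' fanProd S T =
      fanProd (PointedCone.map f '' S) (PointedCone.map g '' T) := by
  have key : ∀ (σ : PointedCone ℝ V) (τ : PointedCone ℝ W),
      PointedCone.map (f.prodMap g) (Submodule.prod σ τ) =
        Submodule.prod (PointedCone.map f σ) (PointedCone.map g τ) := by
    intro σ τ
    ext ⟨x, y⟩
    simp only [PointedCone.mem_map, Submodule.mem_prod]
    constructor
    · rintro ⟨⟨a, b⟩, h, hx⟩
      cases hx
      exact ⟨⟨a, h.1, rfl⟩, ⟨b, h.2, rfl⟩⟩
    · rintro ⟨⟨a, ha, rfl⟩, ⟨b, hb, rfl⟩⟩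
      exact ⟨(a, b), ⟨ha, hb⟩, rfl⟩
  refine image_fanProd_eq _ ?_ fun σ hσ τ hτ => ⟨_, ⟨σ, hσ, rfl⟩, _, ⟨τ, hτ, rfl⟩, key σ τ⟩
  rintro _ ⟨_, ⟨σ, hσ, rfl⟩, _, ⟨τ, hτ, rfl⟩, rfl⟩
  exact ⟨σ, hσ, τ, hτ, key σ τ⟩

end Product

/-! ### Which cones contain a generator; the rays -/

/-- If `u_{a+1} ≥ 0` the inequality for the sum is automatic; otherwise it is the triangle condition
at `(a, a+1)`. The condition at `(a-1, a)` is void because `u_a > 0`. -/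
theorem pellLE_stdVec {d a : ℕ} (ha : a < d) {u : Fin d → ℝ} :
    PellLE u (stdVec d (a + 1)) ↔
      0 < u ⟨a, ha⟩ ∧ ∀ h : a + 1 < d, 0 < u ⟨a, ha⟩ + u ⟨a + 1, h⟩ := by
  constructor
  · intro h
    have h0 : 0 < u ⟨a, ha⟩ := (h.1 a ha).pos (by simp [stdVec])
    refine ⟨h0, fun h1 => ?_⟩
    rcases le_or_gt 0 (u ⟨a + 1, h1⟩) with h2 | h2
    · linarith
    · exact (h.2 a h1 h0 h2).pos (by simp [stdVec])
  · rintro ⟨h0, h1⟩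
    refine ⟨fun k hk => ?_, fun k hk hp hn => ?_⟩
    · by_cases hka : k = a
      · subst hka
        exact signLE_of_pos h0 (by simp [stdVec])
      · simpa [stdVec, hka] using SignLE.zero _
    · by_cases hka : k = a
      · subst hka
        exact signLE_of_pos (h1 hk) (by simp [stdVec])
      · by_cases hka' : k + 1 = a
        · subst hka'
          linarith
        · simpa [stdVec, hka, hka'] using SignLE.zero _

theorem pellLE_neg_stdVec {d a : ℕ} (ha : a < d) {u : Fin d → ℝ} :
    PellLE u (-stdVec d (a + 1)) ↔
      u ⟨a, ha⟩ < 0 ∧ ∀ (b : ℕ) (h : b + 1 = a), u ⟨b, by omega⟩ + u ⟨a, ha⟩ < 0 := by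
  constructor
  · intro h
    have h0 : u ⟨a, ha⟩ < 0 := (h.1 a ha).neg (by simp [stdVec])
    refine ⟨h0, ?_⟩
    rintro b rfl
    rcases le_or_gt (u ⟨b, by omega⟩) 0 with h2 | h2
    · linarith
    · exact (h.2 b ha h2 h0).neg (by simp [stdVec])
  · rintro ⟨h0, h1⟩
    refine ⟨fun k hk => ?_, fun k hk hp hn => ?_⟩
    · by_cases hka : k = a
      · subst hka
        exact signLE_of_neg h0 (by simp [stdVec])
      · simpa [stdVec, hka] using SignLE.zero _
    · by_cases hka : k = a
      · subst hka
        linarith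
      · by_cases hka' : k + 1 = a
        · subst hka'
          exact signLE_of_neg (h1 k rfl) (by simp [stdVec])
        · simpa [stdVec, hka, hka'] using SignLE.zero _

/-- The sum of the two nonzero coordinates of the vector is zero, so the triangle condition at `(a,
a+1)` costs nothing, and those at the neighbouring pairs are void. -/
theorem pellLE_stdVec_sub {d a : ℕ} (ha : a + 1 < d) {u : Fin d → ℝ} :
    PellLE u (stdVec d (a + 1) - stdVec d (a + 2)) ↔
      0 < u ⟨a, by omega⟩ ∧ u ⟨a + 1, ha⟩ < 0 := by
  constructor
  · intro h
    exact ⟨(h.1 a _).pos (by simp [stdVec]), (h.1 (a + 1) ha).neg (by simp [stdVec])⟩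
  · rintro ⟨h0, h1⟩
    refine ⟨fun k hk => ?_, fun k hk hp hn => ?_⟩
    · by_cases hka : k = a
      · subst hka
        exact signLE_of_pos h0 (by simp [stdVec])
      · by_cases hka' : k = a + 1
        · subst hka'
          exact signLE_of_neg h1 (by simp [stdVec])
        · simpa [stdVec, hka, hka'] using SignLE.zero _
    · by_cases hka : k = a
      · subst hka
        simpa [stdVec] using SignLE.zero _
      · by_cases hka' : k + 1 = a
        · subst hka'
          linarith
        · by_cases hka'' : k = a + 1
          · subst hka''
            linarith
          · simpa [stdVec, hka, hka', hka''] using SignLE.zero _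

/-- A positive coordinate directly followed by a negative one gives a difference vector. Without
such a pair, any nonzero coordinate gives plus or minus a basis vector, since its relevant neighbour
cannot spoil the sign of the sum. -/
theorem exists_pellGenerator_mem {d : ℕ} {u : Fin d → ℝ} (hu : u ≠ 0) :
    ∃ v ∈ pellGenerators d, PellLE u v := by
  by_cases h : ∃ (a : ℕ) (ha : a + 1 < d), 0 < u ⟨a, by omega⟩ ∧ u ⟨a + 1, ha⟩ < 0
  · obtain ⟨a, ha, h⟩ := h
    exact ⟨_, Or.inr ⟨a + 1, by omega, ha, rfl⟩, (pellLE_stdVec_sub ha).2 h⟩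
  · push Not at h
    obtain ⟨⟨a, ha⟩, hne⟩ := Function.ne_iff.1 hu
    rcases lt_or_gt_of_ne hne with hlt | hgt
    · refine ⟨_, Or.inl ⟨a + 1, by omega, ha, Or.inr rfl⟩, (pellLE_neg_stdVec ha).2 ⟨hlt, ?_⟩⟩
      rintro b rfl
      by_contra hb
      simp only [Pi.zero_apply] at hlt
      exact absurd (h b ha (by linarith)) (not_le.2 hlt)
    · refine ⟨_, Or.inl ⟨a + 1, by omega, ha, Or.inl rfl⟩, (pellLE_stdVec ha).2 ⟨hgt, ?_⟩⟩
      intro h1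
      have := h a h1 hgt
      simp only [Pi.zero_apply] at hgt
      linarith

theorem pellGenerators_ne_zero {d : ℕ} {v : Fin d → ℝ} (hv : v ∈ pellGenerators d) : v ≠ 0 := by
  rintro rfl
  rcases hv with ⟨i, h1, h2, h | h⟩ | ⟨i, h1, h2, h⟩ <;>
  · have := congrFun h ⟨i - 1, by omega⟩
    simp [stdVec, Nat.sub_add_cancel h1] at this

theorem exists_smul_of_pellLE_generator {d : ℕ} {v w : Fin d → ℝ} (hv : v ∈ pellGenerators d)
    (h : PellLE v w) : ∃ c : ℝ, 0 ≤ c ∧ c • v = w := by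
  rcases hv with ⟨i, h1, h2, hv⟩ | ⟨i, h1, h2, rfl⟩
  · obtain ⟨a, rfl⟩ : ∃ a, i = a + 1 := ⟨i - 1, by omega⟩
    rcases hv with rfl | rfl
    · refine ⟨w ⟨a, h2⟩, (h.1 a h2).1 (by simp [stdVec]), ?_⟩
      ext ⟨k, hk⟩
      by_cases hka : k = a
      · subst hka; simp [stdVec]
      · simp [stdVec, hka, (h.1 k hk).eq_zero (by simp [stdVec, hka])]
    · refine ⟨-w ⟨a, h2⟩, neg_nonneg.2 ((h.1 a h2).2 (by simp [stdVec])), ?_⟩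
      ext ⟨k, hk⟩
      by_cases hka : k = a
      · subst hka; simp [stdVec]
      · simp [stdVec, hka, (h.1 k hk).eq_zero (by simp [stdVec, hka])]
  · obtain ⟨a, rfl⟩ : ∃ a, i = a + 1 := ⟨i - 1, by omega⟩
    have hs : w ⟨a, by omega⟩ + w ⟨a + 1, h2⟩ = 0 :=
      (h.2 a h2 (by simp [stdVec]) (by simp [stdVec])).eq_zero (by simp [stdVec])
    refine ⟨w ⟨a, by omega⟩, (h.1 a _).1 (by simp [stdVec]), ?_⟩
    ext ⟨k, hk⟩
    by_cases hka : k = a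
    · subst hka; simp [stdVec]
    · by_cases hka' : k = a + 1
      · subst hka'
        simp [stdVec]
        linarith
      · simp [stdVec, hka, hka', (h.1 k hk).eq_zero (by simp [stdVec, hka, hka'])]

theorem pellCone_generator {d : ℕ} {v : Fin d → ℝ} (hv : v ∈ pellGenerators d) :
    pellCone v = ray v := by
  refine le_antisymm (fun w hw => ?_) (ray_le_iff.2 (mem_pellCone.2 (.refl v)))
  exact mem_ray.2 (exists_smul_of_pellLE_generator hv (mem_pellCone.1 hw))

theorem fanRays_pellFan (d : ℕ) : fanRays (pellFan d) = ray '' pellGenerators d := by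
  ext ρ
  constructor
  · rintro ⟨⟨u, rfl⟩, hρ⟩
    change Module.finrank ℝ (linSpan (pellCone u)) = 1 at hρ
    change pellCone u ∈ _
    have hu : u ≠ 0 := by
      rintro rfl
      have : linSpan (pellCone (0 : Fin d → ℝ)) = ⊥ := by
        rw [linSpan, Submodule.span_eq_bot]
        intro w hw
        ext ⟨k, hk⟩
        exact ((mem_pellCone.1 hw).1 k hk).eq_zero rfl
      rw [this, finrank_bot] at hρ
      exact zero_ne_one hρ
    obtain ⟨v, hv, huv⟩ := exists_pellGenerator_mem hu
    have hvu : v ∈ pellCone u := mem_pellCone.2 huv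
    refine ⟨v, hv, le_antisymm (ray_le_iff.2 hvu) fun w hw => ?_⟩
    have hv' : v ∈ linSpan (pellCone u) := Submodule.subset_span hvu
    have hw' : w ∈ linSpan (pellCone u) := Submodule.subset_span hw
    obtain ⟨c, hc⟩ := exists_smul_eq_of_finrank_eq_one hρ (x := (⟨v, hv'⟩ : linSpan (pellCone u)))
      (fun h => pellGenerators_ne_zero hv (congrArg Subtype.val h)) ⟨w, hw'⟩
    have hc' : c • v = w := congrArg Subtype.val hc
    -- A nonpositive multiple `w` of `v` would put both `w` and `-w` in the cone, which forces `w =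
    -- 0`.
    rcases le_total 0 c with h0 | h0
    · exact mem_ray.2 ⟨c, h0, hc'⟩
    · have hneg : -w ∈ pellCone u := by
        rw [← hc', ← neg_smul]
        exact (pellCone u).smul_mem (neg_nonneg.2 h0) hvu
      rw [(mem_pellCone.1 hw).eq_zero_of_neg (mem_pellCone.1 hneg)]
      exact Submodule.zero_mem _
  · rintro ⟨v, hv, rfl⟩
    refine ⟨pellCone_generator hv ▸ pellCone_mem_pellFan v, ?_⟩
    rw [linSpan_ray, finrank_span_singleton (pellGenerators_ne_zero hv)]

/-! ### Stars at plus or minus a basis vector -/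

/-- For cones containing `v`, `h₁` and `h₂` say that `f` carries the cone of `u` onto `c (f u)`;
`h₃` says that every index of `c` arises from such a `u`. -/
theorem image_star_pellFan {d : ℕ} {W : Type*} [AddCommGroup W] [Module ℝ W] (v : Fin d → ℝ)
    (f : (Fin d → ℝ) →ₗ[ℝ] W) (c : W → PointedCone ℝ W)
    (h₁ : ∀ u w, PellLE u v → PellLE u w → f w ∈ c (f u))
    (h₂ : ∀ u, PellLE u v → ∀ y ∈ c (f u), ∃ w, PellLE u w ∧ f w = y)
    (h₃ : ∀ y, ∃ u, PellLE u v ∧ f u = y) :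
    PointedCone.map f '' {σ ∈ pellFan d | v ∈ σ} = Set.range c := by
  have key : ∀ u, PellLE u v → PointedCone.map f (pellCone u) = c (f u) := by
    intro u hu
    ext y
    rw [PointedCone.mem_map]
    constructor
    · rintro ⟨w, hw, rfl⟩
      exact h₁ u w hu (mem_pellCone.1 hw)
    · intro hy
      obtain ⟨w, hw, rfl⟩ := h₂ u hu y hy
      exact ⟨w, mem_pellCone.2 hw, rfl⟩
  ext C
  constructor
  · rintro ⟨_, ⟨⟨u, rfl⟩, hv⟩, rfl⟩
    exact ⟨f u, (key u (mem_pellCone.1 hv)).symm⟩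
  · rintro ⟨y, rfl⟩
    obtain ⟨u, hu, rfl⟩ := h₃ y
    exact ⟨pellCone u, ⟨pellCone_mem_pellFan u, mem_pellCone.2 hu⟩, key u hu⟩

theorem fanProd_range {V W : Type*} [AddCommGroup V] [Module ℝ V] [AddCommGroup W] [Module ℝ W]
    (c : V → PointedCone ℝ V) (c' : W → PointedCone ℝ W) :
    fanProd (Set.range c) (Set.range c') =
      Set.range fun y : V × W => Submodule.prod (c y.1) (c' y.2) := by
  ext C
  constructor
  · rintro ⟨_, ⟨x, rfl⟩, _, ⟨y, rfl⟩, rfl⟩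
    exact ⟨(x, y), rfl⟩
  · rintro ⟨⟨x, y⟩, rfl⟩
    exact ⟨_, ⟨x, rfl⟩, _, ⟨y, rfl⟩, rfl⟩

section Coordinate

variable {a b d : ℕ} (h : a + 1 + b = d)

/-- Forgetting the coordinate with (zero-based) index `a`. -/
def dropCoord : (Fin d → ℝ) →ₗ[ℝ] (Fin a → ℝ) × (Fin b → ℝ) :=
  (LinearMap.funLeft ℝ ℝ fun k : Fin a => (⟨k.val, by omega⟩ : Fin d)).prod
    (LinearMap.funLeft ℝ ℝ fun k : Fin b => (⟨a + 1 + k.val, by omega⟩ : Fin d))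

theorem exists_insertCoord (y : (Fin a → ℝ) × (Fin b → ℝ)) (t : ℝ) :
    ∃ w : Fin d → ℝ, w ⟨a, by omega⟩ = t ∧ dropCoord h w = y := by
  refine ⟨fun k => if h1 : k.val < a then y.1 ⟨k.val, h1⟩ else if h2 : k.val = a then t else
    y.2 ⟨k.val - (a + 1), by omega⟩, by simp, Prod.ext (funext fun k => ?_) (funext fun k => ?_)⟩
  · simp [dropCoord, LinearMap.funLeft]
  · have h1 : ¬ (a + 1 + k.val < a) := by omega
    have h2 : ¬ (a + 1 + k.val = a) := by omega
    simp [dropCoord, LinearMap.funLeft, h1, h2]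

theorem dropCoord_surjective : Function.Surjective (dropCoord h) := fun y =>
  (exists_insertCoord h y 0).imp fun _ hw => hw.2

theorem ker_dropCoord : LinearMap.ker (dropCoord h) = Submodule.span ℝ {stdVec d (a + 1)} := by
  ext x
  rw [LinearMap.mem_ker, Submodule.mem_span_singleton]
  constructor
  · intro hx
    refine ⟨x ⟨a, by omega⟩, ?_⟩
    ext ⟨k, hk⟩
    rcases lt_trichotomy k a with hka | rfl | hka
    · have : x ⟨k, hk⟩ = 0 := congrFun (congrArg Prod.fst hx) ⟨k, hka⟩
      simp [stdVec, hka.ne, this]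
    · simp [stdVec]
    · obtain ⟨m, rfl⟩ := Nat.exists_eq_add_of_lt hka
      have : x ⟨a + 1 + m, by omega⟩ = 0 := congrFun (congrArg Prod.snd hx) ⟨m, by omega⟩
      simp only [show a + m + 1 = a + 1 + m by omega]
      rw [this]
      simp [stdVec]
      omega
  · rintro ⟨c, rfl⟩
    refine Prod.ext (funext fun k => ?_) (funext fun k => ?_)
    · simp [dropCoord, LinearMap.funLeft, stdVec, k.2.ne]
    · simp [dropCoord, LinearMap.funLeft, stdVec]
      omega

theorem PellLE.dropCoord {u w : Fin d → ℝ} (huw : PellLE u w) :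
    PellLE (dropCoord h u).1 (dropCoord h w).1 ∧ PellLE (dropCoord h u).2 (dropCoord h w).2 :=
  ⟨⟨fun k hk => huw.1 k (by omega), fun k hk => huw.2 k (by omega)⟩,
    ⟨fun k hk => huw.1 (a + 1 + k) (by omega), fun k hk => huw.2 (a + 1 + k) (by omega)⟩⟩

/-- Only three conditions involve coordinate `a`: its own sign and the sums with its two neighbours.
The remaining ones lie within one block. -/
theorem pellLE_of_dropCoord {u w : Fin d → ℝ}
    (h₁ : PellLE (dropCoord h u).1 (dropCoord h w).1)
    (h₂ : PellLE (dropCoord h u).2 (dropCoord h w).2)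
    (ha : SignLE (u ⟨a, by omega⟩) (w ⟨a, by omega⟩))
    (hl : ∀ (c : ℕ) (hc : c + 1 = a), 0 < u ⟨c, by omega⟩ → u ⟨a, by omega⟩ < 0 →
      SignLE (u ⟨c, by omega⟩ + u ⟨a, by omega⟩) (w ⟨c, by omega⟩ + w ⟨a, by omega⟩))
    (hr : ∀ (hc : a + 1 < d), 0 < u ⟨a, by omega⟩ → u ⟨a + 1, hc⟩ < 0 →
      SignLE (u ⟨a, by omega⟩ + u ⟨a + 1, hc⟩) (w ⟨a, by omega⟩ + w ⟨a + 1, hc⟩)) :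
    PellLE u w := by
  constructor
  · intro k hk
    rcases lt_trichotomy k a with hka | rfl | hka
    · exact h₁.1 k hka
    · exact ha
    · obtain ⟨m, rfl⟩ := Nat.exists_eq_add_of_le (Nat.succ_le_of_lt hka)
      exact h₂.1 m (by omega)
  · intro k hk
    rcases lt_trichotomy k a with hka | rfl | hka
    · rcases Nat.lt_or_ge (k + 1) a with hka' | hka'
      · exact h₁.2 k hka'
      · obtain rfl : k + 1 = a := by omega
        exact hl k rfl
    · exact hr hk
    · obtain ⟨m, rfl⟩ := Nat.exists_eq_add_of_le (Nat.succ_le_of_lt hka)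
      exact h₂.2 m (by omega)

theorem neg_norm_le_apply {n : ℕ} (y : Fin n → ℝ) (k : Fin n) : -‖y‖ ≤ y k :=
  (abs_le.1 (norm_le_pi_norm y k)).1

theorem apply_le_norm {n : ℕ} (y : Fin n → ℝ) (k : Fin n) : y k ≤ ‖y‖ :=
  (abs_le.1 (norm_le_pi_norm y k)).2

theorem exists_fanIso_pellFan_stdVec (v : Fin d → ℝ)
    (hv : v = stdVec d (a + 1) ∨ v = -stdVec d (a + 1)) :
    ∃ φ : ((Fin d → ℝ) ⧸ linSpan (ray v)) ≃ₗ[ℝ] (Fin a → ℝ) × (Fin b → ℝ),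
      (∀ x : Fin d → ℝ, φ ((linSpan (ray v)).mkQ x) = dropCoord h x) ∧
      IsFanIso φ (fanStar (pellFan d) (ray v)) (fanProd (pellFan a) (pellFan b)) := by
  have hker : LinearMap.ker (dropCoord h) = Submodule.span ℝ {v} := by
    rw [ker_dropCoord]
    rcases hv with rfl | rfl
    · rfl
    · rw [← Set.neg_singleton, Submodule.span_neg]
  refine exists_fanIso _ _ v (dropCoord h) (dropCoord_surjective h) hker ?_
  rw [pellFan_eq_range a, pellFan_eq_range b, fanProd_range]
  refine image_star_pellFan v _ _ ?_ ?_ ?_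
  · intro u w _ huw
    exact ⟨mem_pellCone.2 (huw.dropCoord h).1, mem_pellCone.2 (huw.dropCoord h).2⟩
  · rintro u hu y ⟨hy₁, hy₂⟩
    replace hy₁ := mem_pellCone.1 hy₁
    replace hy₂ := mem_pellCone.1 hy₂
    rcases hv with rfl | rfl
    · obtain ⟨h0, h1⟩ := (pellLE_stdVec (by omega)).1 hu
      -- The deleted coordinate is free. The sup norm bounds the next coordinate from below by
      -- `-‖y.2‖`, so the sum is nonnegative.
      obtain ⟨w, hw, rfl⟩ := exists_insertCoord h y ‖y.2‖
      refine ⟨w, pellLE_of_dropCoord h hy₁ hy₂ ?_ ?_ ?_, rfl⟩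
      · exact signLE_of_pos h0 (hw ▸ norm_nonneg _)
      · intro c hc _ hn
        exact absurd hn h0.not_gt
      · intro hc _ _
        refine signLE_of_pos (h1 hc) ?_
        have : -‖(dropCoord h w).2‖ ≤ w ⟨a + 1, hc⟩ := neg_norm_le_apply _ ⟨0, by omega⟩
        linarith
    · obtain ⟨h0, h1⟩ := (pellLE_neg_stdVec (by omega)).1 hu
      obtain ⟨w, hw, rfl⟩ := exists_insertCoord h y (-‖y.1‖)
      refine ⟨w, pellLE_of_dropCoord h hy₁ hy₂ ?_ ?_ ?_, rfl⟩
      · exact signLE_of_neg h0 (hw ▸ neg_nonpos.2 (norm_nonneg _))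
      · intro c hc _ _
        refine signLE_of_neg (h1 c hc) ?_
        have : w ⟨c, by omega⟩ ≤ ‖(dropCoord h w).1‖ :=
          apply_le_norm (dropCoord h w).1 ⟨c, by omega⟩
        linarith
      · intro hc hp _
        exact absurd hp h0.not_gt
  · intro y
    rcases hv with rfl | rfl
    -- The extra `1` makes the inequalities strict, as membership of `v` requires.
    · obtain ⟨u, hu, rfl⟩ := exists_insertCoord h y (‖y.2‖ + 1)
      refine ⟨u, (pellLE_stdVec (by omega)).2 ⟨?_, fun hc => ?_⟩, rfl⟩
      · rw [hu]
        positivity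
      · have : -‖(dropCoord h u).2‖ ≤ u ⟨a + 1, hc⟩ := neg_norm_le_apply _ ⟨0, by omega⟩
        linarith
    · obtain ⟨u, hu, rfl⟩ := exists_insertCoord h y (-(‖y.1‖ + 1))
      refine ⟨u, (pellLE_neg_stdVec (by omega)).2 ⟨?_, fun c hc => ?_⟩, rfl⟩
      · rw [hu, neg_lt_zero]
        positivity
      · have : u ⟨c, by omega⟩ ≤ ‖(dropCoord h u).1‖ :=
          apply_le_norm (dropCoord h u).1 ⟨c, by omega⟩
        linarith

end Coordinate

/-! ### Stars at a difference of consecutive basis vectors -/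

section Sum

variable {a b d : ℕ} (h : a + 2 + b = d)

/-- Replacing the coordinates with (zero-based) indices `a` and `a + 1` by their sum. -/
def sumCoord : (Fin d → ℝ) →ₗ[ℝ] (Fin a → ℝ) × (Fin 1 → ℝ) × (Fin b → ℝ) :=
  (LinearMap.funLeft ℝ ℝ fun k : Fin a => (⟨k.val, by omega⟩ : Fin d)).prod
    ((LinearMap.funLeft ℝ ℝ (fun _ : Fin 1 => (⟨a, by omega⟩ : Fin d)) +
      LinearMap.funLeft ℝ ℝ (fun _ : Fin 1 => (⟨a + 1, by omega⟩ : Fin d))).prod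
      (LinearMap.funLeft ℝ ℝ fun k : Fin b => (⟨a + 2 + k.val, by omega⟩ : Fin d)))

theorem exists_splitCoord (y : (Fin a → ℝ) × (Fin 1 → ℝ) × (Fin b → ℝ)) (s t : ℝ)
    (hst : s + t = y.2.1 0) :
    ∃ w : Fin d → ℝ, w ⟨a, by omega⟩ = s ∧ w ⟨a + 1, by omega⟩ = t ∧ sumCoord h w = y := by
  refine ⟨fun k => if h1 : k.val < a then y.1 ⟨k.val, h1⟩ else if h2 : k.val = a then s else
    if h3 : k.val = a + 1 then t else y.2.2 ⟨k.val - (a + 2), by omega⟩, by simp, by simp,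
    Prod.ext (funext fun k => ?_) (Prod.ext (funext fun k => ?_) (funext fun k => ?_))⟩
  · simp [sumCoord, LinearMap.funLeft]
  · simpa [sumCoord, LinearMap.funLeft, Subsingleton.elim k 0] using hst
  · have h1 : ¬ (a + 2 + k.val < a) := by omega
    have h2 : ¬ (a + 2 + k.val = a) := by omega
    have h3 : ¬ (a + 2 + k.val = a + 1) := by omega
    simp [sumCoord, LinearMap.funLeft, h1, h2, h3]

theorem sumCoord_surjective : Function.Surjective (sumCoord h) := fun y =>
  (exists_splitCoord h y (y.2.1 0) 0 (add_zero _)).imp fun _ hw => hw.2.2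

theorem ker_sumCoord : LinearMap.ker (sumCoord h) =
    Submodule.span ℝ {stdVec d (a + 1) - stdVec d (a + 2)} := by
  ext x
  rw [LinearMap.mem_ker, Submodule.mem_span_singleton]
  constructor
  · intro hx
    refine ⟨x ⟨a, by omega⟩, ?_⟩
    have hs : x ⟨a, by omega⟩ + x ⟨a + 1, by omega⟩ = 0 :=
      congrFun (congrArg (fun y => y.2.1) hx) 0
    ext ⟨k, hk⟩
    rcases lt_trichotomy k a with hka | rfl | hka
    · have : x ⟨k, hk⟩ = 0 := congrFun (congrArg Prod.fst hx) ⟨k, hka⟩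
      have hne : k ≠ a + 1 := by omega
      simp [stdVec, hka.ne, hne, this]
    · simp [stdVec]
    · obtain ⟨m, rfl⟩ := Nat.exists_eq_add_of_le (Nat.succ_le_of_lt hka)
      rcases m with _ | m
      · simp [stdVec]
        linarith
      · have : x ⟨a + 2 + m, by omega⟩ = 0 :=
          congrFun (congrArg (fun y => y.2.2) hx) ⟨m, by omega⟩
        have h1 : ¬ (a + 2 + m = a) := by omega
        have h2 : ¬ (a + 2 + m = a + 1) := by omega
        simp only [show a.succ + (m + 1) = a + 2 + m by omega]
        rw [this]
        simp [stdVec, h1, h2]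
  · rintro ⟨c, rfl⟩
    refine Prod.ext (funext fun k => ?_) (Prod.ext (funext fun k => ?_) (funext fun k => ?_))
    · have hne : k.val ≠ a + 1 := by omega
      simp [sumCoord, LinearMap.funLeft, stdVec, k.2.ne, hne]
    · simp [sumCoord, LinearMap.funLeft, stdVec]
    · have h1 : ¬ (a + 2 + k.val = a) := by omega
      have h2 : ¬ (a + 2 + k.val = a + 1) := by omega
      simp [sumCoord, LinearMap.funLeft, stdVec, h1, h2]

/-- The signs of `u` at `a` and `a + 1` void the sum conditions linking the pair to the outer
blocks, and activate the one inside it, which is the only condition of `Σ_1` on the sum. -/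
theorem pellLE_iff_sumCoord {u w : Fin d → ℝ} (hp : 0 < u ⟨a, by omega⟩)
    (hn : u ⟨a + 1, by omega⟩ < 0) :
    PellLE u w ↔ (0 ≤ w ⟨a, by omega⟩ ∧ w ⟨a + 1, by omega⟩ ≤ 0) ∧
      PellLE (sumCoord h u).1 (sumCoord h w).1 ∧ PellLE (sumCoord h u).2.1 (sumCoord h w).2.1 ∧
      PellLE (sumCoord h u).2.2 (sumCoord h w).2.2 := by
  constructor
  · intro huw
    refine ⟨⟨(huw.1 _ _).1 hp.le, (huw.1 _ _).2 hn.le⟩,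
      ⟨fun k hk => huw.1 k (by omega), fun k hk => huw.2 k (by omega)⟩,
      ⟨fun k hk => huw.2 a (by omega) hp hn, fun k hk => absurd hk (by omega)⟩,
      ⟨fun k hk => huw.1 (a + 2 + k) (by omega), fun k hk => huw.2 (a + 2 + k) (by omega)⟩⟩
  · rintro ⟨⟨hwp, hwn⟩, h₁, h₂, h₃⟩
    constructor
    · intro k hk
      rcases lt_trichotomy k a with hka | rfl | hka
      · exact h₁.1 k hka
      · exact signLE_of_pos hp hwp
      · rcases Nat.lt_or_ge (a + 1) k with hka' | hka'
        · obtain ⟨m, rfl⟩ := Nat.exists_eq_add_of_le (Nat.succ_le_of_lt hka')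
          exact h₃.1 m (by omega)
        · obtain rfl : k = a + 1 := by omega
          exact signLE_of_neg hn hwn
    · intro k hk hkp hkn
      rcases lt_trichotomy k a with hka | rfl | hka
      · rcases Nat.lt_or_ge (k + 1) a with hka' | hka'
        · exact h₁.2 k hka' hkp hkn
        · obtain rfl : k + 1 = a := by omega
          exact absurd hp hkn.not_gt
      · exact h₂.1 0 one_pos
      · rcases Nat.lt_or_ge (a + 1) k with hka' | hka'
        · obtain ⟨m, rfl⟩ := Nat.exists_eq_add_of_le (Nat.succ_le_of_lt hka')
          exact h₃.2 m (by omega) hkp hkn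
        · obtain rfl : k = a + 1 := by omega
          exact absurd hn hkp.not_gt

theorem exists_fanIso_pellFan_stdVec_sub (v : Fin d → ℝ)
    (hv : v = stdVec d (a + 1) - stdVec d (a + 2)) :
    ∃ φ : ((Fin d → ℝ) ⧸ linSpan (ray v)) ≃ₗ[ℝ] (Fin a → ℝ) × (Fin 1 → ℝ) × (Fin b → ℝ),
      (∀ x : Fin d → ℝ, φ ((linSpan (ray v)).mkQ x) = sumCoord h x) ∧
      IsFanIso φ (fanStar (pellFan d) (ray v))
        (fanProd (pellFan a) (fanProd (pellFan 1) (pellFan b))) := by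
  subst hv
  refine exists_fanIso _ _ _ (sumCoord h) (sumCoord_surjective h) (ker_sumCoord h) ?_
  rw [pellFan_eq_range a, pellFan_eq_range b, pellFan_eq_range 1, fanProd_range, fanProd_range]
  refine image_star_pellFan _ _ _ ?_ ?_ ?_
  · intro u w hu huw
    obtain ⟨hp, hn⟩ := (pellLE_stdVec_sub (by omega)).1 hu
    obtain ⟨-, h₁, h₂, h₃⟩ := (pellLE_iff_sumCoord h hp hn).1 huw
    exact ⟨mem_pellCone.2 h₁, mem_pellCone.2 h₂, mem_pellCone.2 h₃⟩
  · rintro u hu y ⟨hy₁, hy₂, hy₃⟩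
    obtain ⟨hp, hn⟩ := (pellLE_stdVec_sub (by omega)).1 hu
    -- Every real `s` splits as `|s| + (s - |s|)`, a nonnegative plus a nonpositive number.
    obtain ⟨w, hw₁, hw₂, rfl⟩ := exists_splitCoord h y |y.2.1 0| (y.2.1 0 - |y.2.1 0|) (by ring)
    refine ⟨w, (pellLE_iff_sumCoord h hp hn).2 ⟨⟨?_, ?_⟩, mem_pellCone.1 hy₁, mem_pellCone.1 hy₂,
      mem_pellCone.1 hy₃⟩, rfl⟩
    · exact hw₁ ▸ abs_nonneg _
    · exact hw₂ ▸ sub_nonpos.2 (le_abs_self _)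
  · intro y
    obtain ⟨u, hu₁, hu₂, rfl⟩ := exists_splitCoord h y (|y.2.1 0| + 1)
      (y.2.1 0 - (|y.2.1 0| + 1)) (by ring)
    refine ⟨u, (pellLE_stdVec_sub (by omega)).2 ⟨?_, ?_⟩, rfl⟩
    · rw [hu₁]
      positivity
    · rw [hu₂]
      linarith [le_abs_self ((sumCoord h u).2.1 0)]

end Sum

/-! ### Assembly, discarding the factors `Σ_0` -/

theorem mainTheorem7 (d : ℕ) (hd : 1 ≤ d) :
    -- the rays of the fan
    (fanRays (pellFan d) = ray '' pellGenerators d) ∧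
    -- the rays of `e_1` and `-e_1`
    (∀ v : Fin d → ℝ, (v = stdVec d 1 ∨ v = -stdVec d 1) →
      ∃ φ : ((Fin d → ℝ) ⧸ linSpan (ray v)) ≃ₗ[ℝ] (Fin (d - 1) → ℝ),
        (∀ x : Fin d → ℝ, φ ((linSpan (ray v)).mkQ x) =
          fun k => x ⟨k.val + 1, by omega⟩) ∧
        IsFanIso φ (fanStar (pellFan d) (ray v)) (pellFan (d - 1))) ∧
    -- the rays of `e_d` and `-e_d`
    (∀ v : Fin d → ℝ, (v = stdVec d d ∨ v = -stdVec d d) →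
      ∃ φ : ((Fin d → ℝ) ⧸ linSpan (ray v)) ≃ₗ[ℝ] (Fin (d - 1) → ℝ),
        (∀ x : Fin d → ℝ, φ ((linSpan (ray v)).mkQ x) =
          fun k => x ⟨k.val, by omega⟩) ∧
        IsFanIso φ (fanStar (pellFan d) (ray v)) (pellFan (d - 1))) ∧
    -- the rays of `e_i` and `-e_i` for `1 < i < d`
    (∀ i : ℕ, ∀ _ : 1 < i, ∀ _ : i < d,
      ∀ v : Fin d → ℝ, (v = stdVec d i ∨ v = -stdVec d i) →
      ∃ φ : ((Fin d → ℝ) ⧸ linSpan (ray v)) ≃ₗ[ℝ] (Fin (i - 1) → ℝ) × (Fin (d - i) → ℝ),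
        (∀ x : Fin d → ℝ, φ ((linSpan (ray v)).mkQ x) =
          (fun k => x ⟨k.val, by omega⟩, fun k => x ⟨i + k.val, by omega⟩)) ∧
        IsFanIso φ (fanStar (pellFan d) (ray v))
          (fanProd (pellFan (i - 1)) (pellFan (d - i)))) ∧
    -- the ray of `e_1 - e_2`
    (∀ _ : 2 ≤ d, ∀ v : Fin d → ℝ, v = stdVec d 1 - stdVec d 2 →
      ∃ φ : ((Fin d → ℝ) ⧸ linSpan (ray v)) ≃ₗ[ℝ] (Fin (d - 2) → ℝ) × (Fin 1 → ℝ),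
        (∀ x : Fin d → ℝ, φ ((linSpan (ray v)).mkQ x) =
          (fun k => x ⟨k.val + 2, by omega⟩,
            fun _ => x ⟨0, by omega⟩ + x ⟨1, by omega⟩)) ∧
        IsFanIso φ (fanStar (pellFan d) (ray v))
          (fanProd (pellFan (d - 2)) (pellFan 1))) ∧
    -- the ray of `e_{d-1} - e_d`
    (∀ _ : 2 ≤ d, ∀ v : Fin d → ℝ, v = stdVec d (d - 1) - stdVec d d →
      ∃ φ : ((Fin d → ℝ) ⧸ linSpan (ray v)) ≃ₗ[ℝ] (Fin (d - 2) → ℝ) × (Fin 1 → ℝ),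
        (∀ x : Fin d → ℝ, φ ((linSpan (ray v)).mkQ x) =
          (fun k => x ⟨k.val, by omega⟩,
            fun _ => x ⟨d - 2, by omega⟩ + x ⟨d - 1, by omega⟩)) ∧
        IsFanIso φ (fanStar (pellFan d) (ray v))
          (fanProd (pellFan (d - 2)) (pellFan 1))) ∧
    -- the rays of `e_i - e_{i+1}` for `2 ≤ i ≤ d - 2`
    (∀ i : ℕ, ∀ _ : 2 ≤ i, ∀ _ : i + 2 ≤ d,
      ∀ v : Fin d → ℝ, v = stdVec d i - stdVec d (i + 1) →
      ∃ φ : ((Fin d → ℝ) ⧸ linSpan (ray v)) ≃ₗ[ℝ]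
          (Fin (i - 1) → ℝ) × (Fin 1 → ℝ) × (Fin (d - i - 1) → ℝ),
        (∀ x : Fin d → ℝ, φ ((linSpan (ray v)).mkQ x) =
          (fun k => x ⟨k.val, by omega⟩,
            fun _ => x ⟨i - 1, by omega⟩ + x ⟨i, by omega⟩,
            fun k => x ⟨i + 1 + k.val, by omega⟩)) ∧
        IsFanIso φ (fanStar (pellFan d) (ray v))
          (fanProd (pellFan (i - 1)) (fanProd (pellFan 1) (pellFan (d - i - 1))))) := by
  refine ⟨fanRays_pellFan d, ?_, ?_, ?_, ?_, ?_, ?_⟩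
  · intro v hv
    refine exists_fanIso_comp (exists_fanIso_pellFan_stdVec (a := 0) (b := d - 1) (by omega) v hv)
      LinearEquiv.uniqueProd (image_snd_fanProd (pellFan_nonempty 0) _) _ fun x => ?_
    funext k
    exact congrArg x (Fin.ext (by simp; omega))
  · intro v hv
    obtain ⟨a, rfl⟩ : ∃ a, d = a + 1 := ⟨d - 1, by omega⟩
    exact exists_fanIso_comp (exists_fanIso_pellFan_stdVec (a := a) (b := 0) (by omega) v hv)
      LinearEquiv.prodUnique (image_fst_fanProd _ (pellFan_nonempty 0)) _ fun x => rfl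
  · intro i hi hid v hv
    obtain ⟨a, rfl⟩ : ∃ a, i = a + 1 := ⟨i - 1, by omega⟩
    exact exists_fanIso_pellFan_stdVec (a := a) (b := d - (a + 1)) (by omega) v hv
  · intro h2 v hv
    -- With `a = 0` the star is `Σ_0 × (Σ_1 × Σ_{d-2})`; the zero-dimensional factor is dropped and
    -- the other two are swapped.
    refine exists_fanIso_comp
      (exists_fanIso_pellFan_stdVec_sub (a := 0) (b := d - 2) (by omega) v hv)
      (LinearEquiv.uniqueProd.trans (LinearEquiv.prodComm ℝ _ _)) ?_ _ fun x => ?_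
    · have hswap := image_swap_fanProd (pellFan 1) (pellFan (d - 2))
      rw [← image_snd_fanProd (pellFan_nonempty 0) (fanProd (pellFan 1) (pellFan (d - 2))),
        Set.image_image] at hswap
      exact (Set.image_congr fun C _ => by rw [PointedCone.map_map]; rfl).trans hswap
    · exact Prod.ext (funext fun k => congrArg x (Fin.ext (by simp; omega))) rfl
  · intro h2 v hv
    obtain ⟨a, rfl⟩ : ∃ a, d = a + 2 := ⟨d - 2, by omega⟩
    refine exists_fanIso_comp (exists_fanIso_pellFan_stdVec_sub (a := a) (b := 0) (by omega) v hv)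
      ((LinearEquiv.refl ℝ _).prodCongr LinearEquiv.prodUnique) ?_ _ fun x => rfl
    refine (image_prodMap_fanProd (pellFan a) (fanProd (pellFan 1) (pellFan 0)) LinearMap.id
      (LinearMap.fst ℝ (Fin 1 → ℝ) (Fin 0 → ℝ))).trans ?_
    rw [image_fst_fanProd _ (pellFan_nonempty 0)]
    simp only [PointedCone.map_id, Set.image_id']
    rfl
  · intro i hi hid v hv
    obtain ⟨a, rfl⟩ : ∃ a, i = a + 1 := ⟨i - 1, by omega⟩
    exact exists_fanIso_pellFan_stdVec_sub (a := a) (b := d - (a + 1) - 1) (by omega) v hv
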